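/- There is an absolute constant $C>0$ such that the following holds. Let $n,d,k$ be natural numbers with $2\le d\le n$ and $k\le n$, let $0<\sigma\le 1$, let $x'_1,\dots,x'_n\in[0,1]^d$ be arbitrary, and let $x_p=x'_p+g_p$ for $p=1,\dots,n$, where $g_1,\dots,g_n$ are independent $d$-dimensional Gaussian vectors with mean $0$ and covariance matrix $\sigma^2 I_d$. Consider the $k$-means method on $x_1,\dots,x_n$. It starts with arbitrary centers $c_1,\dots,c_k\in\mathbb{R}^d$ (initial centers that coincide count as one center). In each iteration every data point is first assigned to a cluster whose center is closest to it (ties between distinct centers are broken arbitrarily), clusters without points are removed, and then each center is moved to the center of mass of its cluster. The potential is $\Psi=\sum_{p}\|x_p-c(x_p)\|^2$, where $c(x_p)$ is the center of the cluster to which $x_p$ is currently assigned. For $\varepsilon\ge 0$ let $\delta_\varepsilon$ be the minimum distance between two cluster centers at the beginning of an iteration, over all iterations other than the first one of all possible executions of $k$-means on $x_1,\dots,x_n$, such that (1) the potential drops by at most $\varepsilon$ during this iteration, and (2) at least one data point switches, during this iteration, from one of the two corresponding clusters to the other ($\delta_\varepsilon=\infty$ if there are no such centers). Then for all real numbers $Y\ge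 1$, $e\ge 2$ and $\varepsilon\in[0,1]$, $$\Pr\bigl[\delta_\varepsilon\le Y\varepsilon^{1/e}\bigr]\;\le\;\varepsilon\cdot\left(\frac{C\,n^5\,Y}{\sigma}\right)^{e}.$$ -/

import Mathlib

open MeasureTheory ProbabilityTheory

noncomputable section

namespace KMeans

/-- `d`-dimensional Euclidean space. -/
abbrev Pt (d : ℕ) : Type := EuclideanSpace ℝ (Fin d)

/-- The cluster with label `i` of the clustering `f`, where `f p` is the label of the cluster that
serves the data point with index `p`. -/
def cluster {n k : ℕ} (f : Fin n → Fin k) (i : Fin k) : Finset (Fin n) :=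
  Finset.univ.filter fun p => f p = i

/-- The labels of the clusters that serve at least one point; the other clusters are removed. -/
def alive {n k : ℕ} (f : Fin n → Fin k) : Set (Fin k) := Set.range f

/-- The center of mass of the data points with index in `s` (only used for nonempty `s`). -/
def mass {n d : ℕ} (x : Fin n → Pt d) (s : Finset (Fin n)) : Pt d :=
  (s.card : ℝ)⁻¹ • ∑ p ∈ s, x p

/-- The cluster centers of the clustering `f`, after they have been moved to the centers of mass. -/
def centers {n d k : ℕ} (x : Fin n → Pt d) (f : Fin n → Fin k) (i : Fin k) : Pt d :=
  mass x (cluster f i)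

/-- The potential of the data points `x` with clustering `f` and cluster centers `c`. -/
def potential {n d k : ℕ} (x : Fin n → Pt d) (f : Fin n → Fin k) (c : Fin k → Pt d) : ℝ :=
  ∑ p, ‖x p - c (f p)‖ ^ 2

/-- `f` assigns every data point to a cluster whose center is closest to it, among the centers
`c i` with `i ∈ S`. Ties are broken arbitrarily. -/
def IsClosestAssignment {n d k : ℕ} (x : Fin n → Pt d) (S : Set (Fin k)) (c : Fin k → Pt d)
    (f : Fin n → Fin k) : Prop :=
  ∀ p, f p ∈ S ∧ ∀ j ∈ S, ‖x p - c (f p)‖ ≤ ‖x p - c j‖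

/-- One iteration after the first one: the centers are the centers of mass of the nonempty
clusters of `f`, the points are reassigned to the closest of these centers, which yields the
clustering `f'`, and then the centers are moved to the centers of mass of the clusters of `f'`. -/
def Step {n d k : ℕ} (x : Fin n → Pt d) (f f' : Fin n → Fin k) : Prop :=
  IsClosestAssignment x (alive f) (centers x f) f'

/-- The clusterings that can occur at the end of an iteration of some execution of `k`-means on
the data points `x`. The initial centers `c` are arbitrary. If some of them coincide, they are one
and the same center: only one label of each group of coinciding initial centers serves points. -/
inductive Reachable {n d k : ℕ} (x : Fin n → Pt d) : (Fin n → Fin k) → Prop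
  | first (c : Fin k → Pt d) (f : Fin n → Fin k)
      (hf : IsClosestAssignment x Set.univ c f)
      (hc : ∀ p q, c (f p) = c (f q) → f p = f q) : Reachable x f
  | next (f f' : Fin n → Fin k) (hf : Reachable x f) (h : Step x f f') : Reachable x f'

/-- The iteration that leads from the clustering `f` to the clustering `f'` occurs, after the first
iteration, in some execution of `k`-means on the data points `x`. -/
def IsIteration {n d k : ℕ} (x : Fin n → Pt d) (f f' : Fin n → Fin k) : Prop :=
  Reachable x f ∧ Step x f f'

/-- The decrease of the potential during the iteration that leads from `f` to `f'`. -/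
def potentialDrop {n d k : ℕ} (x : Fin n → Pt d) (f f' : Fin n → Fin k) : ℝ :=
  potential x f (centers x f) - potential x f' (centers x f')

/-- `minCenterDist k x ε` is the minimum distance between two cluster centers at the beginning of
an iteration (after the first one) of `k`-means on `x` in which the potential drops by at most `ε`
and at least one data point switches between the two clusters. It is `⊤` if there is no such
iteration; otherwise it is attained, because there are only finitely many clusterings. -/
def minCenterDist {n d : ℕ} (k : ℕ) (x : Fin n → Pt d) (ε : ℝ) : ENNReal :=
  sInf {r | ∃ (f f' : Fin n → Fin k) (p : Fin n), IsIteration x f f' ∧ potentialDrop x f f' ≤ ε ∧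
    f p ≠ f' p ∧ r = edist (centers x f (f p)) (centers x f (f' p))}

end KMeans

end

/-! Put `δ = Y * ε ^ (1 / e)`, so that `δ ^ e = Y ^ e * ε`. Let a point switch between clusters `A`
and `B` whose centers are within `δ`. Almost surely disjoint sets have distinct centers of mass, so
`A` and `B` are separated by the bisector of the older centers that produced them. Separated sets
with close centers of mass lie near a common hyperplane (`mem_nearGraph_of_separated`).

Many points near a hyperplane are unlikely: at most `d` of them control the hyperplane, and each of
`s` further points costs a factor `δ / σ` up to a polynomial in `n` (`gaussianPi_nearGraph_le`).
With `s = max d ⌈e⌉₊` this survives a union bound over sets of `d + s` points.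

Otherwise `A` and `B` have fewer than `d + s` points together, so there are few such pairs. If `e ≤
d`, closeness of the two centers alone has probability of order `δ ^ d`
(`gaussianPi_mass_close_le`). If `e > d`, that exponent is too small; instead, the gain of the
switching point lies in `[0, ε]`, and as a quadratic function of two Gaussian coordinates it does so
with probability linear in `ε` (`gaussianPi_switch_le`).

Each estimate freezes all but a few coordinates (`gaussianPi_le_of_slices`) and uses the bounded
density of the others. -/

namespace KMeans

open scoped ENNReal

/-! ### Products of Gaussians and slicing -/

/-- The density of a real Gaussian with standard deviation `σ` is at most `1 / (2 * σ)`. -/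
lemma gaussianReal_le_smul_volume (m : ℝ) {σ : ℝ} (hσ : 0 < σ) :
    gaussianReal m (σ ^ 2).toNNReal ≤ ENNReal.ofReal (1 / (2 * σ)) • (volume : Measure ℝ) := by
  have hv : (σ ^ 2).toNNReal ≠ 0 := by simp [hσ.ne']
  rw [gaussianReal_of_var_ne_zero _ hv, ← withDensity_const]
  refine withDensity_mono (Filter.Eventually.of_forall fun x => ?_)
  refine ENNReal.ofReal_le_ofReal ?_
  -- With 2 in place of `√(2π)`, an interval of length `2 * h` has measure at most `h / σ`.
  rw [gaussianPDFReal, Real.coe_toNNReal _ (sq_nonneg σ), one_div, ← mul_one ((2 * σ)⁻¹)]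
  gcongr
  · rw [show 2 * σ = √(2 ^ 2 * σ ^ 2) by
      rw [Real.sqrt_mul (by positivity), Real.sqrt_sq (by norm_num), Real.sqrt_sq hσ.le]]
    refine Real.sqrt_le_sqrt ?_
    have := Real.pi_gt_three
    nlinarith [sq_nonneg σ]
  · rw [Real.exp_le_one_iff, neg_div]
    exact neg_nonpos.mpr (by positivity)

/-- A product of measures with density at most `c` has density at most `c ^ card`. -/
lemma pi_le_smul_volume {ι : Type*} [Fintype ι] (μ : ι → Measure ℝ) [∀ i, SigmaFinite (μ i)]
    {c : ℝ≥0∞} (h0 : c ≠ 0) (htop : c ≠ ∞) (h : ∀ i, μ i ≤ c • volume) :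
    Measure.pi μ ≤ c ^ Fintype.card ι • (volume : Measure (ι → ℝ)) := by
  have hc0 : c ^ Fintype.card ι ≠ 0 := pow_ne_zero _ h0
  have hct : c ^ Fintype.card ι ≠ ∞ := ENNReal.pow_ne_top htop
  -- The product outer measure is the largest one bounded by the product of side measures on boxes,
  -- so boxes suffice.
  have key : (c ^ Fintype.card ι)⁻¹ • (Measure.pi μ).toOuterMeasure
      ≤ OuterMeasure.pi fun _ : ι => (volume : Measure ℝ).toOuterMeasure := by
    refine OuterMeasure.le_pi.mpr fun s _ => ?_
    change (c ^ Fintype.card ι)⁻¹ * Measure.pi μ (Set.univ.pi s) ≤ ∏ i, volume (s i)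
    rw [Measure.pi_pi]
    calc (c ^ Fintype.card ι)⁻¹ * ∏ i, μ i (s i)
        ≤ (c ^ Fintype.card ι)⁻¹ * ∏ i, (c * volume (s i)) := by
          gcongr with i
          exact h i (s i)
      _ = ∏ i, volume (s i) := by
          rw [Finset.prod_mul_distrib, Finset.prod_const, Finset.card_univ, ← mul_assoc,
            ENNReal.inv_mul_cancel hc0 hct, one_mul]
  refine Measure.le_iff.mpr fun s hs => ?_
  have h1 := key s
  have h2 : (volume : Measure (ι → ℝ)) s
      = OuterMeasure.pi (fun _ : ι => (volume : Measure ℝ).toOuterMeasure) s := by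
    rw [volume_pi, Measure.pi, toMeasure_apply _ _ hs]
  rw [← h2] at h1
  change (c ^ Fintype.card ι)⁻¹ * Measure.pi μ s ≤ _ at h1
  rw [Measure.smul_apply, smul_eq_mul]
  calc Measure.pi μ s
      = c ^ Fintype.card ι * ((c ^ Fintype.card ι)⁻¹ * Measure.pi μ s) := by
        rw [← mul_assoc, ENNReal.mul_inv_cancel hc0 hct, one_mul]
    _ ≤ _ := by gcongr

/-- The product of real Gaussians with standard deviation `σ` and means `m i`. -/
noncomputable def gaussianPi {ι : Type*} [Fintype ι] (m : ι → ℝ) (σ : ℝ) : Measure (ι → ℝ) :=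
  Measure.pi fun i => gaussianReal (m i) (σ ^ 2).toNNReal

lemma gaussianPi_le {ι : Type*} [Fintype ι] (m : ι → ℝ) {σ : ℝ} (hσ : 0 < σ) :
    gaussianPi m σ ≤ ENNReal.ofReal (1 / (2 * σ)) ^ Fintype.card ι •
      (volume : Measure (ι → ℝ)) :=
  pi_le_smul_volume _ (by simpa using hσ) ENNReal.ofReal_ne_top
    fun i => gaussianReal_le_smul_volume (m i) hσ

/-- The point whose coordinates satisfying `q` are given by `u`, the other ones by `v`. -/
def glue {ι : Type*} (q : ι → Prop) [DecidablePred q] (u : {i // q i} → ℝ)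
    (v : {i // ¬ q i} → ℝ) (i : ι) : ℝ :=
  if h : q i then u ⟨i, h⟩ else v ⟨i, h⟩

lemma glue_pos {ι : Type*} {q : ι → Prop} [DecidablePred q] (u : {i // q i} → ℝ)
    (v : {i // ¬ q i} → ℝ) {i : ι} (h : q i) : glue q u v i = u ⟨i, h⟩ := dif_pos h

lemma glue_neg {ι : Type*} {q : ι → Prop} [DecidablePred q] (u : {i // q i} → ℝ)
    (v : {i // ¬ q i} → ℝ) {i : ι} (h : ¬ q i) : glue q u v i = v ⟨i, h⟩ := dif_neg h

/-- If all slices in the coordinates satisfying `q` have Gaussian measure at most `c`, then so has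
the whole set. -/
lemma gaussianPi_le_of_slices {ι : Type*} [Fintype ι] (m : ι → ℝ) (σ : ℝ)
    (q : ι → Prop) [DecidablePred q] {S : Set (ι → ℝ)} (hS : MeasurableSet S) {c : ℝ≥0∞}
    (h : ∀ v : {i // ¬ q i} → ℝ,
      gaussianPi (fun i : {i // q i} => m i) σ {u | glue q u v ∈ S} ≤ c) :
    gaussianPi m σ S ≤ c := by
  have hp := measurePreserving_piEquivPiSubtypeProd
    (fun i => gaussianReal (m i) (σ ^ 2).toNNReal) q
  set e := MeasurableEquiv.piEquivPiSubtypeProd (fun _ : ι => ℝ) q with he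
  have h1 : gaussianPi m σ S = ((Measure.pi fun i : Subtype q => gaussianReal (m i)
      (σ ^ 2).toNNReal).prod (Measure.pi fun i : {i // ¬ q i} => gaussianReal (m i)
      (σ ^ 2).toNNReal)) (e.symm ⁻¹' S) := (hp.symm e).measure_preimage_equiv S |>.symm
  rw [h1, Measure.prod_apply_symm (e.symm.measurable hS)]
  calc _ ≤ ∫⁻ _ : {i // ¬ q i} → ℝ, c ∂(Measure.pi fun i : {i // ¬ q i} => gaussianReal (m i)
      (σ ^ 2).toNNReal) := lintegral_mono fun v => h v
    _ = c := by simp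

/-- A product of Gaussians gives small measure to small boxes. -/
lemma gaussianPi_box_le {ι : Type*} [Fintype ι] (m : ι → ℝ) {σ : ℝ} (hσ : 0 < σ) (a : ι → ℝ)
    (h : ℝ) :
    gaussianPi m σ {u | ∀ i, |u i - a i| ≤ h} ≤ ENNReal.ofReal (h / σ) ^ Fintype.card ι := by
  have h1 : {u : ι → ℝ | ∀ i, |u i - a i| ≤ h} = Set.univ.pi fun i => Metric.closedBall (a i) h := by
    ext u
    simp [Real.dist_eq]
  refine (gaussianPi_le m hσ _).trans ?_
  rw [h1, Measure.smul_apply, volume_pi_pi]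
  simp only [Real.volume_closedBall, Finset.prod_const, Finset.card_univ, smul_eq_mul]
  rw [← mul_pow, ← ENNReal.ofReal_mul (by positivity)]
  refine le_of_eq ?_
  congr 2
  field_simp

instance {ι : Type*} [Fintype ι] (m : ι → ℝ) (σ : ℝ) : IsProbabilityMeasure (gaussianPi m σ) := by
  unfold gaussianPi
  infer_instance

/-! ### The law of the perturbed points -/

/-- The characteristic functions agree. This reduces everything to independent real coordinates. -/
lemma multivariateGaussian_smul_one {ι : Type*} [Fintype ι] [DecidableEq ι] (σ : ℝ) :
    multivariateGaussian 0 (σ ^ 2 • (1 : Matrix ι ι ℝ))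
      = (gaussianPi (fun _ => 0) σ).map (WithLp.toLp 2) := by
  have hS : (σ ^ 2 • (1 : Matrix ι ι ℝ)).PosSemidef :=
    Matrix.PosSemidef.one.smul (sq_nonneg σ)
  apply Measure.ext_of_charFun (E := EuclideanSpace ℝ ι)
  ext t
  unfold gaussianPi
  simp_rw [charFun_multivariateGaussian hS, charFun_pi, charFun_gaussianReal, ← Complex.exp_sum]
  congr 1
  simp only [inner_zero_right, Complex.ofReal_zero, zero_mul, zero_sub, mul_zero,
    Finset.sum_neg_distrib, Matrix.smul_mulVec, Matrix.one_mulVec, dotProduct, Pi.smul_apply,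
    smul_eq_mul, Complex.ofReal_sum]
  rw [Finset.sum_div]
  refine congrArg _ (Finset.sum_congr rfl fun i _ => ?_)
  simp only [Real.coe_toNNReal _ (sq_nonneg σ)]
  push_cast
  ring

/-- The joint law of the coordinates of independent Gaussian perturbations of given points. -/
lemma map_perturbed_eq_gaussianPi {n d : ℕ} {σ : ℝ} (x' : Fin n → Pt d)
    {Ω : Type*} [MeasurableSpace Ω] (P : Measure Ω) [IsProbabilityMeasure P]
    (G : Fin n → Ω → EuclideanSpace ℝ (Fin d)) (hG : iIndepFun G P)
    (hlaw : ∀ p, HasLaw (G p)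
      (multivariateGaussian 0 (σ ^ 2 • (1 : Matrix (Fin d) (Fin d) ℝ))) P) :
    P.map (fun ω (i : Fin n × Fin d) => (x' i.1 + G i.1 ω) i.2)
      = gaussianPi (fun i => x' i.1 i.2) σ := by
  have hae : ∀ p, AEMeasurable (G p) P := fun p => (hlaw p).aemeasurable
  have hpi := (iIndepFun_iff_map_fun_eq_pi_map hae).mp hG
  simp_rw [fun p => (hlaw p).map_eq, multivariateGaussian_smul_one] at hpi
  have hmeas : Measurable fun (g : Fin n → Pt d) (i : Fin n × Fin d) => (x' i.1 + g i.1) i.2 := by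
    fun_prop
  have h1 : P.map (fun ω (i : Fin n × Fin d) => (x' i.1 + G i.1 ω) i.2)
      = (P.map fun ω p => G p ω).map fun g i => (x' i.1 + g i.1) i.2 := by
    rw [AEMeasurable.map_map_of_aemeasurable hmeas.aemeasurable (by fun_prop)]
    rfl
  rw [h1, hpi]
  symm
  have : IsProbabilityMeasure ((gaussianPi (fun _ : Fin d => 0) σ).map (WithLp.toLp 2)) :=
    Measure.isProbabilityMeasure_map (by fun_prop)
  refine Measure.pi_eq fun s hs => ?_
  rw [Measure.map_apply hmeas (.univ_pi hs)]
  have h2 : (fun (g : Fin n → Pt d) (i : Fin n × Fin d) => (x' i.1 + g i.1) i.2) ⁻¹' Set.univ.pi s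
      = Set.univ.pi fun p => {g : Pt d | ∀ l, x' p l + g l ∈ s (p, l)} := by
    ext g
    simp
  rw [h2, Measure.pi_pi, Fintype.prod_prod_type]
  refine Finset.prod_congr rfl fun p _ => ?_
  have h3 : MeasurableSet {g : Pt d | ∀ l, x' p l + g l ∈ s (p, l)} := by
    simp only [Set.ofPred_forall]
    refine MeasurableSet.iInter fun l => ?_
    exact (show Measurable fun g : Pt d => x' p l + g l by fun_prop) (hs (p, l))
  rw [Measure.map_apply (by fun_prop) h3]
  have h4 : (WithLp.toLp 2) ⁻¹' {g : Pt d | ∀ l, x' p l + g l ∈ s (p, l)}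
      = Set.univ.pi fun l => (fun t => x' p l + t) ⁻¹' s (p, l) := by
    ext g
    simp
  unfold gaussianPi
  rw [h4, Measure.pi_pi]
  refine Finset.prod_congr rfl fun l _ => ?_
  rw [← Measure.map_apply (by fun_prop) (hs (p, l)), gaussianReal_map_const_add, zero_add]

/-! ### Many points near a hyperplane -/

/-- A finite family of vectors contains at most `dim V` members such that all members are linear
combinations of these with coefficients in `[-1, 1]`. -/
lemma exists_barycentric_spanner {ι V : Type*} [Finite ι] [AddCommGroup V] [Module ℝ V]
    [FiniteDimensional ℝ V] (y : ι → V) :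
    ∃ r ≤ Module.finrank ℝ V, ∃ (g : Fin r → ι) (c : ι → Fin r → ℝ),
      (∀ o i, |c o i| ≤ 1) ∧ ∀ o, y o = ∑ i, c o i • y (g i) := by
  classical
  rcases isEmpty_or_nonempty ι with hι | hι
  · exact ⟨0, Nat.zero_le _, Fin.elim0, fun _ => Fin.elim0, fun o => isEmptyElim o,
      fun o => isEmptyElim o⟩
  set W := Submodule.span ℝ (Set.range y) with hW
  let z : ι → W := fun o => ⟨y o, Submodule.subset_span ⟨o, rfl⟩⟩
  have hz : Submodule.span ℝ (Set.range z) = ⊤ := by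
    have h1 : Set.range z = ((↑) : W → V) ⁻¹' Set.range y := by
      ext w
      simp only [Set.mem_range, Set.mem_preimage, z, Subtype.ext_iff]
    rw [h1, hW, Submodule.span_span_coe_preimage]
  let b := Module.finBasis ℝ W
  -- Choose the members that span the largest volume.
  obtain ⟨g, hg⟩ := Finite.exists_max fun g : Fin (Module.finrank ℝ W) → ι => |b.det (z ∘ g)|
  have hdet : b.det (z ∘ g) ≠ 0 := by
    obtain ⟨t, htr, htsp, htli⟩ := exists_linearIndependent ℝ (Set.range z)
    rw [hz] at htsp
    let B : Module.Basis t ℝ W := Module.Basis.mk htli (by simp [htsp])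
    have := Module.Basis.linearIndependent B |>.finite
    let e : t ≃ Fin (Module.finrank ℝ W) := B.indexEquiv b
    choose f hf using fun w : t => htr w.2
    have h1 : z ∘ (f ∘ e.symm) = B.reindex e := by
      ext i
      simp [B, hf]
    have h2 : b.det (z ∘ (f ∘ e.symm)) ≠ 0 := by
      rw [h1]
      exact (b.isUnit_det _).ne_zero
    exact abs_pos.mp ((abs_pos.mpr h2).trans_le (hg _))
  have hb : LinearIndependent ℝ (z ∘ g) ∧ Submodule.span ℝ (Set.range (z ∘ g)) = ⊤ :=
    (Module.Basis.is_basis_iff_det b).mpr hdet.isUnit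
  let B : Module.Basis _ ℝ W := Module.Basis.mk hb.1 hb.2.ge
  refine ⟨_, Submodule.finrank_le W, g, fun o i => B.repr (z o) i, fun o i => ?_, fun o => ?_⟩
  -- Cramer's rule: the coefficient is the ratio of the determinants after and before a replacement,
  -- at most 1 in absolute value by maximality.
  · have h1 := congrArg (fun L => L (z o)) (b.det_smul_mk_coord_eq_det_update hb.1 hb.2.ge i)
    simp only [LinearMap.smul_apply, smul_eq_mul, MultilinearMap.toLinearMap_apply,
      Module.Basis.coord_apply] at h1
    have h2 : Function.update (z ∘ g) i (z o) = z ∘ Function.update g i o :=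
      (Function.comp_update z g i o).symm
    have h3 := hg (Function.update g i o)
    rw [← h2] at h3
    have h4 : |b.det (z ∘ g)| * |B.repr (z o) i| ≤ |b.det (z ∘ g)| := by
      rw [← abs_mul]
      exact (congrArg abs h1).le.trans h3
    exact le_of_mul_le_mul_left (by simpa using h4) (abs_pos.mpr hdet)
  · have h1 := congrArg (Subtype.val) (B.sum_repr (z o))
    simp only [B, Module.Basis.mk_apply] at h1
    rw [Submodule.coe_sum] at h1
    exact h1.symm

/-- The points with index in `A` are within (vertical) distance `h` of a hyperplane that is a graph
over the coordinates other than `ℓ`. -/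
def nearGraph {n d : ℕ} (A : Finset (Fin n)) (ℓ : Fin d) (h : ℝ) : Set (Fin n × Fin d → ℝ) :=
  {z | ∃ a : Fin d → ℝ, ∀ q ∈ A, |z (q, ℓ) - ∑ j, a j * (if j = ℓ then 1 else z (q, j))| < h}

/-- The strict inequality in `nearGraph` makes the uncountable union over `a` open, hence
measurable. -/
lemma isOpen_nearGraph {n d : ℕ} (A : Finset (Fin n)) (ℓ : Fin d) (h : ℝ) :
    IsOpen (nearGraph A ℓ h) := by
  have h1 : nearGraph A ℓ h = ⋃ a : Fin d → ℝ, ⋂ q ∈ A,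
      {z | |z (q, ℓ) - ∑ j, a j * (if j = ℓ then 1 else z (q, j))| < h} := by
    ext z
    simp [nearGraph]
  rw [h1]
  refine isOpen_iUnion fun a => A.finite_toSet.isOpen_biInter fun q _ => ?_
  refine isOpen_lt (Continuous.abs (Continuous.sub (by fun_prop) ?_)) continuous_const
  refine continuous_finsetSum _ fun j _ => ?_
  split_ifs <;> fun_prop

/-- It is unlikely that `d + s` points are close to a hyperplane. -/
lemma gaussianPi_nearGraph_le {n d s : ℕ} (m : Fin n × Fin d → ℝ) {σ : ℝ} (hσ : 0 < σ)
    (A : Finset (Fin n)) (hA : d + s ≤ A.card) (ℓ : Fin d) {h : ℝ} (hh : 0 ≤ h) :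
    gaussianPi m σ (nearGraph A ℓ h) ≤ ENNReal.ofReal ((d + 1) * h / σ) ^ s := by
  classical
  refine gaussianPi_le_of_slices m σ (fun i => i.2 = ℓ) (isOpen_nearGraph A ℓ h).measurableSet
    fun v => ?_
  -- The entry 1 at `ℓ` makes `a ℓ` the intercept. All of `y` is frozen, since only the coordinates
  -- `ℓ` still vary.
  let y : Fin n → Fin d → ℝ := fun q j => if hj : j = ℓ then 1 else v ⟨(q, j), hj⟩
  obtain ⟨r, hr, g, c, hgA, hc, hy⟩ : ∃ r ≤ d, ∃ (g : Fin r → Fin n) (c : Fin n → Fin r → ℝ),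
      (∀ i, g i ∈ A) ∧ (∀ o i, |c o i| ≤ 1) ∧ ∀ o ∈ A, y o = ∑ i, c o i • y (g i) := by
    obtain ⟨r, hr, g, c, hc, hy⟩ := exists_barycentric_spanner fun q : A => y q
    rw [Module.finrank_fin_fun] at hr
    refine ⟨r, hr, fun i => g i, fun o => if ho : o ∈ A then c ⟨o, ho⟩ else 0, fun i => (g i).2,
      fun o i => ?_, fun o ho => ?_⟩
    · dsimp only
      split_ifs with ho
      · exact hc _ i
      · simp
    · simpa [ho] using hy ⟨o, ho⟩
  obtain ⟨O, hOA, hOs⟩ : ∃ O ⊆ A \ Finset.univ.image g, O.card = s := by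
    refine Finset.exists_subset_card_eq ?_
    have h1 := Finset.le_card_sdiff (Finset.univ.image g) A
    have h2 := Finset.card_image_le (s := Finset.univ) (f := g)
    rw [Finset.card_univ, Fintype.card_fin] at h2
    omega
  have hO : ∀ o ∈ O, o ∈ A ∧ ∀ i, g i ≠ o := fun o ho => by
    simpa using hOA ho
  let S : Set ({i : Fin n × Fin d // i.2 = ℓ} → ℝ) :=
    {u | ∀ o ∈ O, |u ⟨(o, ℓ), rfl⟩ - ∑ i, c o i * u ⟨(g i, ℓ), rfl⟩| ≤ (d + 1) * h}
  have hsub : {u | glue (fun i : Fin n × Fin d => i.2 = ℓ) u v ∈ nearGraph A ℓ h} ⊆ S := by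
    rintro u ⟨a, ha⟩ o ho
    have hres : ∀ q, (∑ j, a j * if j = ℓ then 1 else
        glue (fun i : Fin n × Fin d => i.2 = ℓ) u v (q, j)) = ∑ j, a j * y q j := by
      intro q
      refine Finset.sum_congr rfl fun j _ => ?_
      by_cases hj : j = ℓ
      · simp [y, hj]
      · simp only [y, hj, if_false, dif_neg, not_false_eq_true]
        rw [glue_neg]
    have hval : ∀ q, glue (fun i : Fin n × Fin d => i.2 = ℓ) u v (q, ℓ) = u ⟨(q, ℓ), rfl⟩ :=
      fun q => glue_pos _ _ _
    simp only [hres, hval] at ha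
    set ρ : Fin n → ℝ := fun q => u ⟨(q, ℓ), rfl⟩ - ∑ j, a j * y q j with hρ
    have hlin : ∑ j, a j * y o j = ∑ i, c o i * ∑ j, a j * y (g i) j := by
      rw [hy o (hO o ho).1]
      simp only [Finset.sum_apply, Pi.smul_apply, smul_eq_mul, Finset.mul_sum]
      rw [Finset.sum_comm]
      refine Finset.sum_congr rfl fun i _ => Finset.sum_congr rfl fun j _ => by ring
    -- The same combination annihilates the affine parts, so the unknown hyperplane `a` drops out.
    have heq : u ⟨(o, ℓ), rfl⟩ - ∑ i, c o i * u ⟨(g i, ℓ), rfl⟩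
        = ρ o - ∑ i, c o i * ρ (g i) := by
      simp only [hρ, mul_sub, Finset.sum_sub_distrib, ← hlin]
      ring
    rw [heq]
    calc |ρ o - ∑ i, c o i * ρ (g i)| ≤ |ρ o| + |∑ i, c o i * ρ (g i)| := abs_sub _ _
      _ ≤ h + ∑ i : Fin r, h := by
        gcongr
        · exact (ha o (hO o ho).1).le
        · refine (Finset.abs_sum_le_sum_abs _ _).trans (Finset.sum_le_sum fun i _ => ?_)
          rw [abs_mul]
          exact (mul_le_of_le_one_left (abs_nonneg _) (hc o i)).trans (ha _ (hgA i)).le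
      _ ≤ (d + 1) * h := by
        rw [Finset.sum_const, Finset.card_univ, Fintype.card_fin, nsmul_eq_mul]
        have : (r : ℝ) ≤ d := by exact_mod_cast hr
        nlinarith
  have hS : MeasurableSet S := by
    have h1 : S = ⋂ o ∈ O,
        {u | |u ⟨(o, ℓ), rfl⟩ - ∑ i, c o i * u ⟨(g i, ℓ), rfl⟩| ≤ (d + 1) * h} := by
      ext u
      simp [S]
    rw [h1]
    refine (isClosed_biInter fun o _ => ?_).measurableSet
    exact isClosed_le (by fun_prop) continuous_const
  refine (measure_mono hsub).trans ?_
  have hcard : Fintype.card {i : {i : Fin n × Fin d // i.2 = ℓ} // i.1.1 ∈ O} = s := by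
    rw [← hOs, ← Fintype.card_coe O]
    exact Fintype.card_congr
      ⟨fun i => ⟨i.1.1.1, i.2⟩, fun o => ⟨⟨(o.1, ℓ), rfl⟩, o.2⟩,
        fun i => by ext <;> simp [i.1.2], fun o => rfl⟩
  -- Freezing the spanning points too leaves `s` free coordinates, each confined to a fixed
  -- interval.
  refine gaussianPi_le_of_slices _ σ (fun i => i.1.1 ∈ O) hS fun w => ?_
  rw [← hcard]
  refine le_trans (measure_mono fun u hu => ?_) (gaussianPi_box_le _ hσ
    (fun i => ∑ t, c i.1.1.1 t * w ⟨⟨(g t, ℓ), rfl⟩, fun hg => (hO _ hg).2 t rfl⟩) _)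
  intro i
  have h1 := hu i.1.1.1 i.2
  have h2 : (⟨(i.1.1.1, ℓ), rfl⟩ : {i : Fin n × Fin d // i.2 = ℓ}) = i.1 := by
    ext <;> simp [i.1.2]
  rw [h2, glue_pos (q := fun i : {i : Fin n × Fin d // i.2 = ℓ} => i.1.1 ∈ O) _ _ i.2] at h1
  convert h1 using 6 with t
  rw [glue_neg]

/-! ### Two close centers of mass -/

/-- The points with the given coordinates. -/
def toPts {n d : ℕ} (z : Fin n × Fin d → ℝ) (p : Fin n) : Pt d := WithLp.toLp 2 fun l => z (p, l)

@[simp] lemma toPts_apply {n d : ℕ} (z : Fin n × Fin d → ℝ) (p : Fin n) (l : Fin d) :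
    toPts z p l = z (p, l) := rfl

lemma mass_apply {n d : ℕ} (x : Fin n → Pt d) (s : Finset (Fin n)) (l : Fin d) :
    mass x s l = (s.card : ℝ)⁻¹ * ∑ p ∈ s, x p l := by
  simp [mass]

lemma continuous_mass_toPts {n d : ℕ} (s : Finset (Fin n)) (l : Fin d) :
    Continuous fun z : Fin n × Fin d → ℝ => mass (toPts z) s l := by
  simp only [mass_apply, toPts_apply]
  fun_prop

/-- The effect on a center of mass of changing coordinates of the point `q` from zero. -/
lemma mass_glue {n d : ℕ} (r : Fin n × Fin d → Prop) [DecidablePred r] {q : Fin n}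
    (hr : ∀ i, r i → i.1 = q) (u : {i // r i} → ℝ) (v : {i // ¬ r i} → ℝ)
    (s : Finset (Fin n)) (l : Fin d) :
    mass (toPts (glue r u v)) s l = mass (toPts (glue r 0 v)) s l
      + if q ∈ s then (s.card : ℝ)⁻¹ * glue r u 0 (q, l) else 0 := by
  have h1 : ∀ p, glue r u v (p, l) = glue r 0 v (p, l)
      + if q = p then glue r u 0 (q, l) else 0 := by
    intro p
    by_cases hp : r (p, l)
    · obtain rfl : p = q := hr _ hp
      rw [glue_pos _ _ hp, glue_pos _ _ hp, if_pos rfl, glue_pos _ _ hp]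
      simp
    · rw [glue_neg _ _ hp, glue_neg _ _ hp]
      split_ifs with h
      · subst h
        rw [glue_neg _ _ hp]
        simp
      · simp
  simp only [mass_apply, toPts_apply]
  rw [Finset.sum_congr rfl fun p _ => h1 p, Finset.sum_add_distrib, mul_add, Finset.sum_ite_eq,
    mul_ite, mul_zero]

/-- It is unlikely that the centers of mass of two given disjoint clusters are close. -/
lemma gaussianPi_mass_close_le {n d : ℕ} (m : Fin n × Fin d → ℝ) {σ : ℝ} (hσ : 0 < σ)
    {A B : Finset (Fin n)} (hAB : Disjoint A B) (hB : B.Nonempty) (δ : ℝ) :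
    gaussianPi m σ {z | ∀ l, |mass (toPts z) A l - mass (toPts z) B l| ≤ δ}
      ≤ ENNReal.ofReal (n * δ / σ) ^ d := by
  obtain ⟨q, hq⟩ := hB
  have hqA : q ∉ A := Finset.disjoint_right.mp hAB hq
  have hmeas : MeasurableSet {z : Fin n × Fin d → ℝ |
      ∀ l, |mass (toPts z) A l - mass (toPts z) B l| ≤ δ} := by
    simp only [Set.ofPred_forall]
    exact (isClosed_iInter fun l => isClosed_le
      ((continuous_mass_toPts A l).sub (continuous_mass_toPts B l)).abs
      continuous_const).measurableSet
  -- Only the point `q` of `B` varies: the center of `A` is fixed and that of `B` moves by `u /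
  -- B.card`, so `u` lies in a box of half-side `B.card * δ`.
  refine gaussianPi_le_of_slices m σ (fun i => i.1 = q) hmeas fun v => ?_
  have hcard : Fintype.card {i : Fin n × Fin d // i.1 = q} = d := by
    refine (Fintype.card_congr (β := Fin d)
      ⟨fun i => i.1.2, fun l => ⟨(q, l), rfl⟩, fun i => ?_, fun l => rfl⟩).trans
      (Fintype.card_fin d)
    ext <;> simp [i.2]
  have hBpos : (0 : ℝ) < B.card := by exact_mod_cast Finset.card_pos.mpr ⟨q, hq⟩
  have hBn : (B.card : ℝ) ≤ n := by exact_mod_cast (Finset.card_le_univ B).trans_eq (by simp)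
  have aux : ∀ b a a' t : ℝ, 0 < b → |t - b * (a - a')| = b * |a + 0 - (a' + b⁻¹ * t)| := by
    intro b a a' t hb
    nth_rewrite 2 [← abs_of_pos hb]
    rw [← abs_mul, ← abs_neg]
    congr 1
    field_simp
    ring
  conv_rhs => rw [← hcard]
  set z₀ := glue (fun i : Fin n × Fin d => i.1 = q) 0 v
  refine le_trans (measure_mono fun u hu => ?_) (gaussianPi_box_le _ hσ
    (fun i => B.card * (mass (toPts z₀) A i.1.2 - mass (toPts z₀) B i.1.2)) _)
  intro i
  have h1 := hu i.1.2
  have hi : (q, i.1.2) = i.1 := by ext <;> simp [i.2]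
  rw [mass_glue _ (fun _ h => h) u v A, mass_glue _ (fun _ h => h) u v B, if_neg hqA, if_pos hq, hi,
    glue_pos (q := fun i : Fin n × Fin d => i.1 = q) _ _ i.2] at h1
  calc |u i - B.card * (mass (toPts z₀) A i.1.2 - mass (toPts z₀) B i.1.2)|
      = B.card * |mass (toPts z₀) A i.1.2 + 0
        - (mass (toPts z₀) B i.1.2 + (B.card : ℝ)⁻¹ * u i)| := by
        exact aux _ _ _ _ hBpos
    _ ≤ n * δ := mul_le_mul hBn h1 (abs_nonneg _) (Nat.cast_nonneg n)

/-! ### A switching point with small gain -/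

/-- The area of an annulus. -/
lemma volume_annulus_le {T : Type*} [Fintype T] (hT : Fintype.card T = 2) (c : T → ℝ)
    (R : ℝ) {η : ℝ} (hη : 0 ≤ η) :
    volume {u : T → ℝ | R - η ≤ ∑ i, (u i - c i) ^ 2 ∧ ∑ i, (u i - c i) ^ 2 ≤ R}
      ≤ ENNReal.ofReal (Real.pi * η) := by
  have hrank : Module.finrank ℝ (EuclideanSpace ℝ T) = 2 * 1 := by simp [hT]
  have : Nontrivial (EuclideanSpace ℝ T) :=
    Module.nontrivial_of_finrank_pos (R := ℝ) (by omega)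
  have hvol : ∀ r, volume (Metric.closedBall (WithLp.toLp 2 c : EuclideanSpace ℝ T) r)
      = ENNReal.ofReal r ^ 2 * ENNReal.ofReal Real.pi := by
    intro r
    rw [InnerProductSpace.volume_closedBall_of_dim_even hrank, hrank]
    simp
  have hdist : ∀ u : T → ℝ, dist (WithLp.toLp 2 u) (WithLp.toLp 2 c : EuclideanSpace ℝ T)
      = √(∑ i, (u i - c i) ^ 2) := by
    intro u
    rw [EuclideanSpace.dist_eq]
    simp [Real.dist_eq]
  have hmp := PiLp.volume_preserving_toLp T
  -- In dimension two the area is linear in the squared radius, so the bound does not depend on `R`.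
  -- In the first case there is no inner disc.
  rcases le_or_gt (R - η) 0 with hR | hR
  · have hsub : {u : T → ℝ | R - η ≤ ∑ i, (u i - c i) ^ 2 ∧ ∑ i, (u i - c i) ^ 2 ≤ R}
        ⊆ WithLp.toLp 2 ⁻¹' Metric.closedBall (WithLp.toLp 2 c : EuclideanSpace ℝ T) √η := by
      rintro u ⟨-, hu⟩
      rw [Set.mem_preimage, Metric.mem_closedBall, hdist]
      exact Real.sqrt_le_sqrt (by linarith)
    refine (measure_mono hsub).trans ?_
    rw [hmp.measure_preimage Metric.isClosed_closedBall.measurableSet.nullMeasurableSet, hvol,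
      ← ENNReal.ofReal_pow (Real.sqrt_nonneg _), ← ENNReal.ofReal_mul (by positivity),
      Real.sq_sqrt hη, mul_comm]
  · have hRpos : 0 ≤ R := by linarith
    set D := Metric.closedBall (WithLp.toLp 2 c : EuclideanSpace ℝ T) √R
    set E := Metric.ball (WithLp.toLp 2 c : EuclideanSpace ℝ T) √(R - η) with hE
    have hsub : {u : T → ℝ | R - η ≤ ∑ i, (u i - c i) ^ 2 ∧ ∑ i, (u i - c i) ^ 2 ≤ R}
        ⊆ WithLp.toLp 2 ⁻¹' (D \ E) := by
      rintro u ⟨hu1, hu2⟩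
      refine ⟨?_, ?_⟩
      · rw [Metric.mem_closedBall, hdist]
        exact Real.sqrt_le_sqrt hu2
      · rw [hE, Metric.mem_ball, hdist, not_lt]
        exact Real.sqrt_le_sqrt hu1
    have hED : E ⊆ D := Metric.ball_subset_closedBall.trans
      (Metric.closedBall_subset_closedBall (Real.sqrt_le_sqrt (by linarith)))
    refine (measure_mono hsub).trans ?_
    rw [hmp.measure_preimage (Metric.isClosed_closedBall.measurableSet.diff
      Metric.isOpen_ball.measurableSet).nullMeasurableSet,
      measure_sdiff hED Metric.isOpen_ball.measurableSet.nullMeasurableSet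
        measure_ball_lt_top.ne, hE, ← Measure.addHaar_closedBall_eq_addHaar_ball, hvol, hvol,
      ← ENNReal.ofReal_pow (Real.sqrt_nonneg _), ← ENNReal.ofReal_mul (by positivity),
      ← ENNReal.ofReal_pow (Real.sqrt_nonneg _), ← ENNReal.ofReal_mul (by positivity),
      Real.sq_sqrt hRpos, Real.sq_sqrt hR.le, ← ENNReal.ofReal_sub _ (by positivity)]
    refine ENNReal.ofReal_le_ofReal (le_of_eq ?_)
    ring

/-- If a quadratic function `K - α * ‖u - c‖²` of two Gaussian coordinates is not too flat, then it
is unlikely that its value is in a given short interval. -/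
lemma gaussianPi_quadratic_le {T : Type*} [Fintype T] (hT : Fintype.card T = 2) (m : T → ℝ) {σ : ℝ}
    (hσ : 0 < σ) (β : T → ℝ) (γ : ℝ) {α η ε : ℝ} (hη : 0 ≤ η) (hα : 0 < α) (hαη : ε ≤ α * η) :
    gaussianPi m σ {u | 0 ≤ γ + ∑ i, (2 * β i * u i - α * u i ^ 2) ∧
        γ + ∑ i, (2 * β i * u i - α * u i ^ 2) ≤ ε}
      ≤ ENNReal.ofReal (η / σ ^ 2) := by
  -- Completing the square gives the value `α * (R - ∑ i, (u i - β i / α) ^ 2)`.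
  set R := (γ + ∑ i, β i ^ 2 / α) / α with hR
  have hsub : {u : T → ℝ | 0 ≤ γ + ∑ i, (2 * β i * u i - α * u i ^ 2) ∧
      γ + ∑ i, (2 * β i * u i - α * u i ^ 2) ≤ ε}
      ⊆ {u | R - η ≤ ∑ i, (u i - β i / α) ^ 2 ∧ ∑ i, (u i - β i / α) ^ 2 ≤ R} := by
    intro u hu
    have h1 : γ + ∑ i, (2 * β i * u i - α * u i ^ 2)
        = α * (R - ∑ i, (u i - β i / α) ^ 2) := by
      rw [hR, mul_sub, mul_div_cancel₀ _ hα.ne', Finset.mul_sum, add_sub_assoc,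
        ← Finset.sum_sub_distrib]
      congr 1
      refine Finset.sum_congr rfl fun i _ => ?_
      field_simp
      ring
    rw [Set.mem_ofPred_eq, h1] at hu
    constructor
    · have := le_of_mul_le_mul_left (hu.2.trans hαη) hα
      linarith
    · have := nonneg_of_mul_nonneg_right hu.1 hα
      linarith
  refine (gaussianPi_le m hσ _).trans ?_
  rw [Measure.smul_apply, smul_eq_mul, hT]
  refine (mul_le_mul_right ((measure_mono hsub).trans (volume_annulus_le hT _ R hη)) _).trans ?_
  rw [← ENNReal.ofReal_pow (by positivity), ← ENNReal.ofReal_mul (by positivity)]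
  refine ENNReal.ofReal_le_ofReal ?_
  have h4 := Real.pi_le_four
  rw [div_pow, one_pow, mul_pow, div_mul_eq_mul_div, one_mul]
  rw [div_le_div_iff₀ (by positivity) (by positivity)]
  have : Real.pi * η ≤ 4 * η := by gcongr
  nlinarith [sq_nonneg σ]

/-- It is unlikely that a given point of the cluster `A` is closer to the center of mass of `B` than
to that of `A` by a small amount only. -/
lemma gaussianPi_switch_le {n d : ℕ} (hd : 2 ≤ d) (m : Fin n × Fin d → ℝ) {σ : ℝ} (hσ : 0 < σ)
    {A B : Finset (Fin n)} (hAB : Disjoint A B) {p : Fin n} (hp : p ∈ A) {ε : ℝ} (hε : 0 ≤ ε) :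
    gaussianPi m σ {z | 0 ≤ ‖toPts z p - mass (toPts z) A‖ ^ 2 - ‖toPts z p - mass (toPts z) B‖ ^ 2
        ∧ ‖toPts z p - mass (toPts z) A‖ ^ 2 - ‖toPts z p - mass (toPts z) B‖ ^ 2 ≤ ε}
      ≤ ENNReal.ofReal (n * ε / σ ^ 2) := by
  have hpB : p ∉ B := Finset.disjoint_left.mp hAB hp
  have hcont : Continuous fun z : Fin n × Fin d → ℝ =>
      ‖toPts z p - mass (toPts z) A‖ ^ 2 - ‖toPts z p - mass (toPts z) B‖ ^ 2 := by
    simp only [EuclideanSpace.real_norm_sq_eq, PiLp.sub_apply, toPts_apply]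
    exact (continuous_finsetSum _ fun l _ =>
        ((continuous_apply (p, l)).sub (continuous_mass_toPts A l)).pow 2).sub
      (continuous_finsetSum _ fun l _ =>
        ((continuous_apply (p, l)).sub (continuous_mass_toPts B l)).pow 2)
  let ℓ₀ : Fin d := ⟨0, by omega⟩
  let ℓ₁ : Fin d := ⟨1, by omega⟩
  let r : Fin n × Fin d → Prop := fun i => i = (p, ℓ₀) ∨ i = (p, ℓ₁)
  have hr : ∀ i, r i → i.1 = p := by
    rintro i (rfl | rfl) <;> rfl
  refine gaussianPi_le_of_slices m σ r
    ((isClosed_le continuous_const hcont).inter (isClosed_le hcont continuous_const)).measurableSet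
    fun v => ?_
  have hT : Fintype.card {i // r i} = 2 := by
    rw [Fintype.card_subtype]
    have : Finset.univ.filter r = {(p, ℓ₀), (p, ℓ₁)} := by
      ext i
      simp [r]
    rw [this, Finset.card_pair]
    simp [ℓ₀, ℓ₁]
  have hApos : (0 : ℝ) < A.card := by exact_mod_cast Finset.card_pos.mpr ⟨p, hp⟩
  have hA1 : (1 : ℝ) ≤ A.card := by exact_mod_cast Finset.card_pos.mpr ⟨p, hp⟩
  have hAn : (A.card : ℝ) ≤ n := by exact_mod_cast (Finset.card_le_univ A).trans_eq (by simp)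
  have hn : (0 : ℝ) < n := hApos.trans_le hAn
  -- Moving `p` by `u` moves its offset from the center of `A` by `κ * u`, as `p ∈ A`, and from that
  -- of `B` by `u`. The quadratic coefficient is thus `κ ^ 2 - 1`, which is at most `-1 / n`.
  set κ : ℝ := 1 - (A.card : ℝ)⁻¹ with hκ
  have hαn : (n : ℝ)⁻¹ ≤ 1 - κ ^ 2 := by
    have h1 : (n : ℝ)⁻¹ ≤ (A.card : ℝ)⁻¹ := inv_anti₀ hApos hAn
    have h2 : (A.card : ℝ)⁻¹ ≤ 1 := inv_le_one_of_one_le₀ hA1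
    have h3 : 0 < (A.card : ℝ)⁻¹ := inv_pos.mpr hApos
    rw [hκ]
    nlinarith
  set z₀ := glue r 0 v with hz₀
  set D : Fin d → ℝ := fun l => z₀ (p, l) - mass (toPts z₀) A l with hD
  set E : Fin d → ℝ := fun l => z₀ (p, l) - mass (toPts z₀) B l with hE
  refine le_trans (measure_mono fun u hu => ?_) (gaussianPi_quadratic_le hT _ hσ
    (fun i => κ * D i.1.2 - E i.1.2) (∑ l, (D l ^ 2 - E l ^ 2)) (α := 1 - κ ^ 2)
    (η := n * ε) (ε := ε) (by positivity) ((inv_pos.mpr hn).trans_le hαn) ?_)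
  · have hpt : ∀ l, glue r u v (p, l) = z₀ (p, l) + glue r u 0 (p, l) := by
      intro l
      by_cases h : r (p, l)
      · simp [hz₀, glue_pos _ _ h]
      · simp [hz₀, glue_neg _ _ h]
    have hval : ‖toPts (glue r u v) p - mass (toPts (glue r u v)) A‖ ^ 2
        - ‖toPts (glue r u v) p - mass (toPts (glue r u v)) B‖ ^ 2
        = ∑ l, (D l ^ 2 - E l ^ 2) + ∑ i : {i // r i},
          (2 * (κ * D i.1.2 - E i.1.2) * u i - (1 - κ ^ 2) * u i ^ 2) := by
      have hsum : ∑ i : {i // r i},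
          (2 * (κ * D i.1.2 - E i.1.2) * u i - (1 - κ ^ 2) * u i ^ 2)
          = ∑ l, (2 * (κ * D l - E l) * glue r u 0 (p, l)
            - (1 - κ ^ 2) * glue r u 0 (p, l) ^ 2) := by
        refine Fintype.sum_of_injective (fun i : {i // r i} => i.1.2) ?_ _ _ ?_ ?_
        · intro i j hij
          exact Subtype.ext (Prod.ext ((hr _ i.2).trans (hr _ j.2).symm) hij)
        · intro l hl
          have h : ¬ r (p, l) := fun h => hl ⟨⟨(p, l), h⟩, rfl⟩
          simp [glue_neg _ _ h]
        · intro i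
          have hi : (p, i.1.2) = i.1 := Prod.ext (hr _ i.2).symm rfl
          rw [hi, glue_pos _ _ i.2]
      rw [hsum, ← Finset.sum_add_distrib, EuclideanSpace.real_norm_sq_eq,
        EuclideanSpace.real_norm_sq_eq, ← Finset.sum_sub_distrib]
      refine Finset.sum_congr rfl fun l _ => ?_
      rw [PiLp.sub_apply, PiLp.sub_apply, toPts_apply, mass_glue r hr u v A, mass_glue r hr u v B,
        if_pos hp, if_neg hpB, hpt]
      simp only [hD, hE, hκ, hz₀]
      ring
    rw [Set.mem_ofPred_eq, Set.mem_inter_iff, Set.mem_ofPred_eq, Set.mem_ofPred_eq, hval] at hu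
    exact hu
  · calc ε = (n : ℝ)⁻¹ * (n * ε) := by field_simp
      _ ≤ _ := by gcongr

/-! ### Deterministic facts about `k`-means -/

lemma mem_cluster {n k : ℕ} {f : Fin n → Fin k} {i : Fin k} {p : Fin n} :
    p ∈ cluster f i ↔ f p = i := by
  simp [cluster]

lemma disjoint_cluster {n k : ℕ} (f : Fin n → Fin k) {i j : Fin k} (hij : i ≠ j) :
    Disjoint (cluster f i) (cluster f j) :=
  Finset.disjoint_left.mpr fun _ hi hj => hij ((mem_cluster.mp hi).symm.trans (mem_cluster.mp hj))

lemma cluster_nonempty {n k : ℕ} {f : Fin n → Fin k} {i : Fin k} (hi : i ∈ alive f) :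
    (cluster f i).Nonempty := by
  obtain ⟨p, hp⟩ := hi
  exact ⟨p, mem_cluster.mpr hp⟩

lemma sum_sub_mass {n d : ℕ} (x : Fin n → Pt d) (s : Finset (Fin n)) :
    ∑ p ∈ s, (x p - mass x s) = 0 := by
  rcases s.eq_empty_or_nonempty with rfl | hs
  · simp
  · have h : (s.card : ℝ) ≠ 0 := by exact_mod_cast hs.card_ne_zero
    rw [Finset.sum_sub_distrib, Finset.sum_const, ← Nat.cast_smul_eq_nsmul ℝ, mass, smul_smul,
      mul_inv_cancel₀ h, one_smul, sub_self]

/-- The center of mass minimizes the sum of the squared distances. -/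
lemma sum_norm_sub_mass_le {n d : ℕ} (x : Fin n → Pt d) (s : Finset (Fin n)) (c : Pt d) :
    ∑ p ∈ s, ‖x p - mass x s‖ ^ 2 ≤ ∑ p ∈ s, ‖x p - c‖ ^ 2 := by
  have h1 : ∀ p, ‖x p - c‖ ^ 2 = ‖x p - mass x s‖ ^ 2
      + 2 * inner ℝ (x p - mass x s) (mass x s - c) + ‖mass x s - c‖ ^ 2 := by
    intro p
    rw [← norm_add_sq_real, sub_add_sub_cancel]
  have h2 : ∑ p ∈ s, 2 * inner ℝ (x p - mass x s) (mass x s - c) = 0 := by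
    rw [← Finset.mul_sum, ← sum_inner, sum_sub_mass, inner_zero_left, mul_zero]
  simp only [h1, Finset.sum_add_distrib, h2, add_zero]
  exact le_add_of_nonneg_right (Finset.sum_nonneg fun _ _ => sq_nonneg _)

lemma potential_centers_le {n d k : ℕ} (x : Fin n → Pt d) (f : Fin n → Fin k) (c : Fin k → Pt d) :
    potential x f (centers x f) ≤ potential x f c := by
  unfold potential
  rw [← Finset.sum_fiberwise (g := f), ← Finset.sum_fiberwise (g := f)]
  refine Finset.sum_le_sum fun i _ => ?_
  rw [Finset.sum_congr rfl fun p hp => by rw [(Finset.mem_filter.mp hp).2]]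
  conv_rhs => rw [Finset.sum_congr rfl fun p hp => by rw [(Finset.mem_filter.mp hp).2]]
  exact sum_norm_sub_mass_le x (cluster f i) (c i)

/-- The potential drops at least by the contribution of each point. -/
lemma Step.le_potentialDrop {n d k : ℕ} {x : Fin n → Pt d} {f f' : Fin n → Fin k}
    (h : Step x f f') (p : Fin n) :
    ‖x p - centers x f (f p)‖ ^ 2 - ‖x p - centers x f (f' p)‖ ^ 2 ≤ potentialDrop x f f' := by
  -- Moving the centers cannot raise the potential, and reassignment raises no point's term, so one
  -- term bounds the drop from below.
  have h1 := potential_centers_le x f' (centers x f)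
  have h2 : ‖x p - centers x f (f p)‖ ^ 2 - ‖x p - centers x f (f' p)‖ ^ 2
      ≤ ∑ q, (‖x q - centers x f (f q)‖ ^ 2 - ‖x q - centers x f (f' q)‖ ^ 2) := by
    refine Finset.single_le_sum
      (f := fun q => ‖x q - centers x f (f q)‖ ^ 2 - ‖x q - centers x f (f' q)‖ ^ 2)
      (fun q _ => ?_) (Finset.mem_univ p)
    exact sub_nonneg.mpr (pow_le_pow_left₀ (norm_nonneg _) ((h q).2 _ ⟨q, rfl⟩) 2)
  rw [Finset.sum_sub_distrib] at h2
  unfold potentialDrop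
  unfold potential at h1 ⊢
  linarith

lemma Step.nonneg {n d k : ℕ} {x : Fin n → Pt d} {f f' : Fin n → Fin k}
    (h : Step x f f') (p : Fin n) :
    0 ≤ ‖x p - centers x f (f p)‖ ^ 2 - ‖x p - centers x f (f' p)‖ ^ 2 :=
  sub_nonneg.mpr (pow_le_pow_left₀ (norm_nonneg _) ((h p).2 _ ⟨p, rfl⟩) 2)

/-- If disjoint sets of data points have different centers of mass, then any two clusters in an
execution of `k`-means are separated by a hyperplane. -/
lemma Reachable.exists_separating {n d k : ℕ} {x : Fin n → Pt d}
    (hx : ∀ A B : Finset (Fin n), Disjoint A B → A.Nonempty → B.Nonempty → mass x A ≠ mass x B)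
    {f : Fin n → Fin k} (hf : Reachable x f) {i j : Fin k} (hij : i ≠ j) (hi : i ∈ alive f)
    (hj : j ∈ alive f) :
    ∃ (a : Pt d) (b : ℝ), a ≠ 0 ∧ (∀ q ∈ cluster f i, inner ℝ a (x q) ≤ b) ∧
      ∀ q ∈ cluster f j, b ≤ inner ℝ a (x q) := by
  -- Here `c` are the centers to which `f` assigned the points, not its centers of mass: distinct by
  -- `hc` in the first iteration, by `hx` later.
  obtain ⟨S, c, hc, hne⟩ : ∃ (S : Set (Fin k)) (c : Fin k → Pt d),
      IsClosestAssignment x S c f ∧ c i ≠ c j := by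
    obtain ⟨p, rfl⟩ := hi
    obtain ⟨q, rfl⟩ := hj
    cases hf with
    | first c _ hf hc => exact ⟨_, c, hf, fun h => hij (hc p q h)⟩
    | next f₀ _ _ h =>
      exact ⟨_, centers x f₀, h, hx _ _ (disjoint_cluster f₀ hij) (cluster_nonempty (h p).1)
        (cluster_nonempty (h q).1)⟩
  have key : ∀ q i j, ‖x q - c i‖ ≤ ‖x q - c j‖ →
      2 * inner ℝ (c j - c i) (x q) ≤ ‖c j‖ ^ 2 - ‖c i‖ ^ 2 := by
    intro q i j h
    have h1 := pow_le_pow_left₀ (norm_nonneg _) h 2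
    rw [norm_sub_sq_real, norm_sub_sq_real] at h1
    rw [inner_sub_left, real_inner_comm, real_inner_comm (x q) (c i)]
    linarith
  have hiS : i ∈ S := by
    obtain ⟨p, rfl⟩ := hi
    exact (hc p).1
  have hjS : j ∈ S := by
    obtain ⟨p, rfl⟩ := hj
    exact (hc p).1
  refine ⟨c j - c i, (‖c j‖ ^ 2 - ‖c i‖ ^ 2) / 2, sub_ne_zero.mpr hne.symm, fun q hq => ?_,
    fun q hq => ?_⟩
  · obtain rfl := mem_cluster.mp hq
    have := key q (f q) j ((hc q).2 j hjS)
    linarith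
  · obtain rfl := mem_cluster.mp hq
    have := key q (f q) i ((hc q).2 i hiS)
    rw [← neg_sub, inner_neg_left] at this
    linarith

/-- If two separated sets of points have close centers of mass, then they are close to a
hyperplane. -/
lemma mem_nearGraph_of_separated {n d : ℕ} {z : Fin n × Fin d → ℝ} {A B : Finset (Fin n)}
    {δ : ℝ} (hδ : 0 < δ) (hclose : ∀ l, |mass (toPts z) A l - mass (toPts z) B l| ≤ δ)
    (hA : A.Nonempty) (hB : B.Nonempty) {a : Pt d} (ha : a ≠ 0) {b : ℝ}
    (h1 : ∀ q ∈ A, inner ℝ a (toPts z q) ≤ b) (h2 : ∀ q ∈ B, b ≤ inner ℝ a (toPts z q)) :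
    ∃ ℓ, z ∈ nearGraph (A ∪ B) ℓ (2 * (n * d * δ)) := by
  obtain ⟨j₀, hj₀⟩ : ∃ j, a j ≠ 0 := by
    by_contra! h
    exact ha (by ext j; simpa using h j)
  have : Nonempty (Fin d) := ⟨j₀⟩
  -- Solving for the coordinate with the largest coefficient keeps the vertical distance free of the
  -- size of `a`.
  obtain ⟨ℓ, hℓ⟩ := Finite.exists_max fun j => |a j|
  have haℓ : 0 < |a ℓ| := (abs_pos.mpr hj₀).trans_le (hℓ j₀)
  refine ⟨ℓ, fun j => if j = ℓ then b / a ℓ else - (a j / a ℓ), fun q hq => ?_⟩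
  have hn : (0 : ℝ) < n := by
    obtain ⟨q, _⟩ := hA
    exact_mod_cast q.pos
  have hd : (0 : ℝ) < d := by exact_mod_cast j₀.pos
  have hcard : ∀ s : Finset (Fin n), (s.card : ℝ) ≤ n := fun s => by
    exact_mod_cast (Finset.card_le_univ s).trans_eq (by simp)
  have hmass : ∀ s : Finset (Fin n), s.Nonempty →
      ∑ q ∈ s, inner ℝ a (toPts z q) = s.card * inner ℝ a (mass (toPts z) s) := by
    intro s hs
    have h : (s.card : ℝ) ≠ 0 := by exact_mod_cast hs.card_ne_zero
    rw [mass, inner_smul_right, inner_sum, ← mul_assoc, mul_inv_cancel₀ h, one_mul]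
  have hdiff : inner ℝ a (mass (toPts z) B) - inner ℝ a (mass (toPts z) A) ≤ d * (|a ℓ| * δ) := by
    rw [← inner_sub_right, PiLp.inner_apply]
    calc _ ≤ ∑ _l : Fin d, |a ℓ| * δ := by
          refine Finset.sum_le_sum fun l _ => (le_abs_self _).trans ?_
          calc _ = |a l| * |mass (toPts z) A l - mass (toPts z) B l| := by
                simp [abs_mul, abs_sub_comm, mul_comm]
            _ ≤ _ := mul_le_mul (hℓ l) (hclose l) (abs_nonneg _) haℓ.le
      _ = _ := by simp
  have hA1 : inner ℝ a (mass (toPts z) A) ≤ b := by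
    have h : (0 : ℝ) < A.card := by exact_mod_cast hA.card_pos
    have h3 := Finset.sum_le_sum h1
    rw [hmass A hA, Finset.sum_const, nsmul_eq_mul] at h3
    exact le_of_mul_le_mul_left h3 h
  have hB1 : b ≤ inner ℝ a (mass (toPts z) B) := by
    have h : (0 : ℝ) < B.card := by exact_mod_cast hB.card_pos
    have h3 := Finset.sum_le_sum h2
    rw [hmass B hB, Finset.sum_const, nsmul_eq_mul] at h3
    exact le_of_mul_le_mul_left h3 h
  have hdn : 0 ≤ d * (|a ℓ| * δ) := by positivity
  -- The value `b` lies between those at the two centers, so the one-sided deviations in each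
  -- cluster average at most the gap; a single one is at most `n` times that.
  have hres : |inner ℝ a (toPts z q) - b| ≤ n * (d * (|a ℓ| * δ)) := by
    rcases Finset.mem_union.mp hq with hq | hq
    · have h3 := Finset.single_le_sum (f := fun q => b - inner ℝ a (toPts z q))
        (fun q hq => sub_nonneg.mpr (h1 q hq)) hq
      rw [Finset.sum_sub_distrib, hmass A hA, Finset.sum_const, nsmul_eq_mul, ← mul_sub] at h3
      rw [abs_sub_comm, abs_of_nonneg (sub_nonneg.mpr (h1 q hq))]
      exact h3.trans (mul_le_mul (hcard A) (by linarith) (by linarith) hn.le)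
    · have h3 := Finset.single_le_sum (f := fun q => inner ℝ a (toPts z q) - b)
        (fun q hq => sub_nonneg.mpr (h2 q hq)) hq
      rw [Finset.sum_sub_distrib, hmass B hB, Finset.sum_const, nsmul_eq_mul, ← mul_sub] at h3
      rw [abs_of_nonneg (sub_nonneg.mpr (h2 q hq))]
      exact h3.trans (mul_le_mul (hcard B) (by linarith) (by linarith) hn.le)
  have heq : z (q, ℓ) - ∑ j, (if j = ℓ then b / a ℓ else - (a j / a ℓ))
      * (if j = ℓ then 1 else z (q, j)) = (inner ℝ a (toPts z q) - b) / a ℓ := by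
    have ha0 : a ℓ ≠ 0 := abs_pos.mp haℓ
    rw [PiLp.inner_apply, ← Finset.add_sum_erase _ _ (Finset.mem_univ ℓ),
      ← Finset.add_sum_erase _ _ (Finset.mem_univ ℓ), Finset.sum_congr rfl (g := fun j =>
        - ((a j * z (q, j)) / a ℓ)) fun j hj => ?_]
    · simp only [if_true, mul_one, Finset.sum_neg_distrib, ← Finset.sum_div]
      simp only [RCLike.inner_apply, conj_trivial, toPts_apply, mul_comm]
      field_simp
      ring
    · simp [Finset.ne_of_mem_erase hj]
      ring
  -- The factor 2 in the width provides the strict inequality.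
  rw [heq, abs_div, div_lt_iff₀ haℓ]
  refine hres.trans_lt ?_
  have : 0 < n * d * δ * |a ℓ| := by positivity
  nlinarith

/-! ### Union bounds -/

/-- Such a set is the image of a map from `Fin M`, with repetitions; nonemptiness supplies values
for the surplus arguments. -/
lemma card_nonempty_finsets_le (α : Type*) [Fintype α] [DecidableEq α] (M : ℕ) :
    (Finset.univ.filter fun C : Finset α => C.Nonempty ∧ C.card ≤ M).card
      ≤ Fintype.card α ^ M := by
  have h1 : (Finset.univ.filter fun C : Finset α => C.Nonempty ∧ C.card ≤ M)
      ⊆ Finset.univ.image fun g : Fin M → α => Finset.univ.image g := by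
    intro C hC
    obtain ⟨⟨a, ha⟩, hcard⟩ := (Finset.mem_filter.mp hC).2
    have : Nonempty C := ⟨⟨a, ha⟩⟩
    obtain ⟨e⟩ : Nonempty (C ↪ Fin M) :=
      Function.Embedding.nonempty_of_card_le (by simpa using hcard)
    refine Finset.mem_image.mpr ⟨fun i => (Function.invFun e i : C), Finset.mem_univ _, ?_⟩
    ext b
    simp only [Finset.mem_image, Finset.mem_univ, true_and]
    constructor
    · rintro ⟨i, rfl⟩
      exact (Function.invFun e i).2
    · intro hb
      exact ⟨e ⟨b, hb⟩, by rw [Function.leftInverse_invFun e.injective]⟩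
  refine (Finset.card_le_card h1).trans (Finset.card_image_le.trans ?_)
  simp

/-- A union bound over disjoint pairs of sets with few elements. -/
lemma measure_iUnion_pairs_le {n M : ℕ} {α : Type*} [MeasurableSpace α] (μ : Measure α)
    (S : Finset (Fin n) → Finset (Fin n) → Set α) {c : ℝ≥0∞}
    (hS : ∀ A B, Disjoint A B → A.Nonempty → B.Nonempty → μ (S A B) ≤ c) :
    μ {z | ∃ A B, Disjoint A B ∧ A.Nonempty ∧ B.Nonempty ∧ A.card + B.card ≤ M ∧ z ∈ S A B}
      ≤ (2 * n) ^ M * c := by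
  classical
  -- A pair is encoded as one subset of `Fin n ⊕ Fin n`, whence the base `2 * n`.
  let I := (Finset.univ.filter fun C : Finset (Fin n ⊕ Fin n) => C.Nonempty ∧ C.card ≤ M).filter
    fun C => Disjoint C.toLeft C.toRight ∧ C.toLeft.Nonempty ∧ C.toRight.Nonempty
  have hI : (I.card : ℝ≥0∞) ≤ (2 * n) ^ M := by
    have h1 := (Finset.card_filter_le (Finset.univ.filter fun C : Finset (Fin n ⊕ Fin n) =>
      C.Nonempty ∧ C.card ≤ M) fun C => Disjoint C.toLeft C.toRight ∧ C.toLeft.Nonempty ∧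
      C.toRight.Nonempty).trans (card_nonempty_finsets_le (Fin n ⊕ Fin n) M)
    rw [Fintype.card_sum, Fintype.card_fin, ← two_mul] at h1
    exact_mod_cast h1
  have hsub : {z | ∃ A B, Disjoint A B ∧ A.Nonempty ∧ B.Nonempty ∧ A.card + B.card ≤ M ∧
      z ∈ S A B} ⊆ ⋃ C ∈ I, S C.toLeft C.toRight := by
    rintro z ⟨A, B, hAB, hA, hB, hM, hz⟩
    refine Set.mem_biUnion (x := A.disjSum B) ?_ (by simpa using hz)
    simp only [I, Finset.coe_filter, Set.mem_ofPred_eq, Finset.mem_filter, Finset.mem_univ,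
      true_and, Finset.toLeft_disjSum, Finset.toRight_disjSum, Finset.card_disjSum]
    refine ⟨⟨?_, hM⟩, hAB, hA, hB⟩
    obtain ⟨a, ha⟩ := hA
    exact ⟨Sum.inl a, Finset.inl_mem_disjSum.mpr ha⟩
  refine (measure_mono hsub).trans ((measure_biUnion_finset_le _ _).trans ?_)
  refine (Finset.sum_le_card_nsmul _ _ c fun C hC => ?_).trans ?_
  · obtain ⟨h1, h2, h3⟩ := (Finset.mem_filter.mp hC).2
    exact hS _ _ h1 h2 h3
  · rw [nsmul_eq_mul]
    gcongr

/-- Almost surely, disjoint sets of data points have different centers of mass. -/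
lemma gaussianPi_mass_eq_null {n d : ℕ} (hd : 0 < d) (m : Fin n × Fin d → ℝ) {σ : ℝ}
    (hσ : 0 < σ) :
    gaussianPi m σ {z | ¬ ∀ A B : Finset (Fin n), Disjoint A B → A.Nonempty → B.Nonempty →
      mass (toPts z) A ≠ mass (toPts z) B} = 0 := by
  -- `M = n + n` is no restriction, and closeness 0 has probability `0 ^ d`.
  have h1 := measure_iUnion_pairs_le (M := n + n) (gaussianPi m σ)
    (fun A B => {z | ∀ l, |mass (toPts z) A l - mass (toPts z) B l| ≤ 0}) (c := 0)
    fun A B hAB _ hB => by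
      refine (gaussianPi_mass_close_le m hσ hAB hB 0).trans_eq ?_
      simp [hd.ne']
  rw [mul_zero, nonpos_iff_eq_zero] at h1
  refine measure_mono_null (fun z hz => ?_) h1
  simp only [Set.mem_ofPred_eq] at hz
  push Not at hz
  obtain ⟨A, B, hAB, hA, hB, h⟩ := hz
  exact ⟨A, B, hAB, hA, hB, add_le_add ((Finset.card_le_univ A).trans_eq (by simp))
    ((Finset.card_le_univ B).trans_eq (by simp)), fun l => by simp [h]⟩

/-- The clusters that are responsible for a small minimum distance. -/
lemma exists_of_minCenterDist_le {n d k : ℕ} {z : Fin n × Fin d → ℝ} {ε δ : ℝ} (hδ : 0 ≤ δ)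
    (hz : ∀ A B : Finset (Fin n), Disjoint A B → A.Nonempty → B.Nonempty →
      mass (toPts z) A ≠ mass (toPts z) B)
    (h : minCenterDist k (toPts z) ε ≤ ENNReal.ofReal δ) :
    ∃ (A B : Finset (Fin n)) (p : Fin n), Disjoint A B ∧ p ∈ A ∧ B.Nonempty ∧
      (∀ l, |mass (toPts z) A l - mass (toPts z) B l| ≤ δ) ∧
      (0 ≤ ‖toPts z p - mass (toPts z) A‖ ^ 2 - ‖toPts z p - mass (toPts z) B‖ ^ 2 ∧
        ‖toPts z p - mass (toPts z) A‖ ^ 2 - ‖toPts z p - mass (toPts z) B‖ ^ 2 ≤ ε) ∧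
      0 < δ ∧ ∃ ℓ, z ∈ nearGraph (A ∪ B) ℓ (2 * (n * d * δ)) := by
  set R := {r | ∃ (f f' : Fin n → Fin k) (p : Fin n), IsIteration (toPts z) f f' ∧
    potentialDrop (toPts z) f f' ≤ ε ∧ f p ≠ f' p ∧
    r = edist (centers (toPts z) f (f p)) (centers (toPts z) f (f' p))} with hR
  -- Finiteness makes the infimum attained, so an actual iteration realizes it.
  have hfin : R.Finite := by
    refine (Set.finite_range fun t : (Fin n → Fin k) × (Fin n → Fin k) × Fin n =>
      edist (centers (toPts z) t.1 (t.1 t.2.2)) (centers (toPts z) t.1 (t.2.1 t.2.2))).subset ?_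
    rintro r ⟨f, f', p, -, -, -, rfl⟩
    exact ⟨(f, f', p), rfl⟩
  have hne : R.Nonempty := by
    by_contra! hemp
    change sInf R ≤ _ at h
    rw [hemp, sInf_empty] at h
    exact ENNReal.ofReal_ne_top (top_le_iff.mp h)
  obtain ⟨f, f', p, ⟨hreach, hstep⟩, hdrop, hp, hr⟩ := hne.csInf_mem hfin
  change sInf R ≤ _ at h
  rw [hr, edist_dist] at h
  have hdist := (ENNReal.ofReal_le_ofReal_iff hδ).mp h
  have hpa : p ∈ cluster f (f p) := mem_cluster.mpr rfl
  have hB := cluster_nonempty (hstep p).1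
  have hclose : ∀ l, |mass (toPts z) (cluster f (f p)) l - mass (toPts z) (cluster f (f' p)) l|
      ≤ δ := by
    intro l
    rw [dist_eq_norm] at hdist
    exact (PiLp.norm_apply_le (centers (toPts z) f (f p) - centers (toPts z) f (f' p)) l).trans
      hdist
  have hpos : 0 < δ := by
    refine lt_of_lt_of_le (dist_pos.mpr ?_) hdist
    exact hz _ _ (disjoint_cluster f hp) ⟨p, hpa⟩ hB
  obtain ⟨a, b, ha, h1, h2⟩ := hreach.exists_separating hz hp ⟨p, rfl⟩ (hstep p).1
  exact ⟨cluster f (f p), cluster f (f' p), p, disjoint_cluster f hp, hpa, hB, hclose,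
    ⟨hstep.nonneg p, (hstep.le_potentialDrop p).trans hdrop⟩, hpos,
    mem_nearGraph_of_separated hpos hclose ⟨p, hpa⟩ hB ha h1 h2⟩

/-- It is unlikely that there are many points close to a hyperplane. -/
lemma gaussianPi_exists_nearGraph_le {n d s : ℕ} (hd : 0 < d) (hdn : d ≤ n) (hds : d ≤ s)
    (m : Fin n × Fin d → ℝ) {σ δ : ℝ} (hσ : 0 < σ) (hδ : 0 ≤ δ) :
    gaussianPi m σ {z | ∃ (A : Finset (Fin n)) (ℓ : Fin d), d + s ≤ A.card ∧
        z ∈ nearGraph A ℓ (2 * (n * d * δ))}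
      ≤ ENNReal.ofReal ((8 * n ^ 5 * δ / σ) ^ s) := by
  have hsub : {z | ∃ (A : Finset (Fin n)) (ℓ : Fin d), d + s ≤ A.card ∧
      z ∈ nearGraph A ℓ (2 * (n * d * δ))} ⊆
      ⋃ t ∈ (Finset.univ : Finset (Fin d)) ×ˢ Finset.powersetCard (d + s) Finset.univ,
        nearGraph t.2 t.1 (2 * (n * d * δ)) := by
    rintro z ⟨A, ℓ, hA, a, ha⟩
    obtain ⟨A', hA', hcard⟩ := Finset.exists_subset_card_eq hA
    exact Set.mem_biUnion (x := (ℓ, A')) (by simp [hcard]) ⟨a, fun q hq => ha q (hA' hq)⟩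
  have hn1 : (1 : ℝ) ≤ n := by exact_mod_cast hd.trans_le hdn
  have hdn' : (d : ℝ) ≤ n := by exact_mod_cast hdn
  refine (measure_mono hsub).trans ((measure_biUnion_finset_le _ _).trans ?_)
  refine (Finset.sum_le_card_nsmul _ _
    (ENNReal.ofReal ((d + 1) * (2 * (n * d * δ)) / σ) ^ s) fun t ht => ?_).trans ?_
  · refine gaussianPi_nearGraph_le m hσ t.2 ?_ t.1 (by positivity)
    exact (Finset.mem_powersetCard.mp (Finset.mem_product.mp ht).2).2.ge
  · have hcard : ((Finset.univ : Finset (Fin d)) ×ˢ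
        Finset.powersetCard (d + s) (Finset.univ : Finset (Fin n))).card ≤ (2 * n ^ 2) ^ s := by
      rw [Finset.card_product, Finset.card_powersetCard, Finset.card_univ, Finset.card_univ,
        Fintype.card_fin, Fintype.card_fin, mul_pow, ← pow_mul]
      -- `d ≤ s` bounds the choices of `ℓ` by `2 ^ s` and the subsets by `n ^ (2 * s)`.
      refine Nat.mul_le_mul (hds.trans Nat.lt_two_pow_self.le) ((Nat.choose_le_pow _ _).trans ?_)
      exact Nat.pow_le_pow_right (hd.trans_le hdn) (by omega)
    rw [nsmul_eq_mul, ← ENNReal.ofReal_pow (by positivity)]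
    calc _ ≤ (((2 * n ^ 2) ^ s : ℕ) : ℝ≥0∞)
          * ENNReal.ofReal (((d + 1) * (2 * (n * d * δ)) / σ) ^ s) := by gcongr
      _ = ENNReal.ofReal ((2 * n ^ 2 * ((d + 1) * (2 * (n * d * δ)) / σ)) ^ s) := by
        rw [← ENNReal.ofReal_natCast, ← ENNReal.ofReal_mul (by positivity), mul_pow (2 * (n : ℝ) ^ 2)]
        push_cast
        rfl
      _ ≤ ENNReal.ofReal ((8 * n ^ 5 * δ / σ) ^ s) := by
        refine ENNReal.ofReal_le_ofReal (pow_le_pow_left₀ (by positivity) ?_ s)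
        calc 2 * (n : ℝ) ^ 2 * ((d + 1) * (2 * (n * d * δ)) / σ)
            ≤ 2 * n ^ 2 * ((n + n) * (2 * (n * n * δ)) / σ) := by gcongr
          _ = _ := by ring

/-- It is unlikely that two small clusters have close centers. -/
lemma gaussianPi_exists_close_le {n d M : ℕ} (hn : 0 < n) (hM : M ≤ 2 * d)
    (m : Fin n × Fin d → ℝ) {σ δ : ℝ} (hσ : 0 < σ) (hδ : 0 ≤ δ) :
    gaussianPi m σ {z | ∃ A B : Finset (Fin n), Disjoint A B ∧ A.Nonempty ∧ B.Nonempty ∧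
        A.card + B.card ≤ M ∧ z ∈ {z | ∀ l, |mass (toPts z) A l - mass (toPts z) B l| ≤ δ}}
      ≤ ENNReal.ofReal ((8 * n ^ 5 * δ / σ) ^ d) := by
  have hn1 : (1 : ℝ) ≤ n := by exact_mod_cast hn
  refine (measure_iUnion_pairs_le _ (fun A B => {z | ∀ l, |mass (toPts z) A l -
    mass (toPts z) B l| ≤ δ}) fun A B hAB _ hB =>
      gaussianPi_mass_close_le m hσ hAB hB δ).trans ?_
  have h1 : (2 * n : ℝ≥0∞) ^ M = ENNReal.ofReal ((2 * n : ℝ) ^ M) := by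
    rw [ENNReal.ofReal_pow (by positivity), ENNReal.ofReal_mul (by norm_num)]
    simp
  rw [h1, ← ENNReal.ofReal_pow (by positivity), ← ENNReal.ofReal_mul (by positivity)]
  refine ENNReal.ofReal_le_ofReal ?_
  calc (2 * n : ℝ) ^ M * (n * δ / σ) ^ d ≤ (2 * n) ^ (2 * d) * (n * δ / σ) ^ d := by
        gcongr
        linarith
    _ = (4 * n ^ 3 * δ / σ) ^ d := by
        rw [pow_mul, ← mul_pow]
        congr 1
        ring
    _ ≤ _ := by
        gcongr
        · norm_num
        · norm_num

/-- It is unlikely that a point switches between two small clusters and this has a small effect. -/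
lemma gaussianPi_exists_switch_le {n d M : ℕ} (hd : 2 ≤ d) (hn : 0 < n) {e : ℝ} (he : 2 ≤ e)
    (hM : (M : ℝ) ≤ 2 * e) (m : Fin n × Fin d → ℝ) {σ ε : ℝ} (hσ : 0 < σ) (hσ1 : σ ≤ 1)
    (hε : 0 ≤ ε) :
    gaussianPi m σ {z | ∃ A B : Finset (Fin n), Disjoint A B ∧ A.Nonempty ∧ B.Nonempty ∧
        A.card + B.card ≤ M ∧ z ∈ {z | ∃ p ∈ A,
          0 ≤ ‖toPts z p - mass (toPts z) A‖ ^ 2 - ‖toPts z p - mass (toPts z) B‖ ^ 2 ∧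
          ‖toPts z p - mass (toPts z) A‖ ^ 2 - ‖toPts z p - mass (toPts z) B‖ ^ 2 ≤ ε}}
      ≤ ENNReal.ofReal (ε * (8 * n ^ 5 / σ) ^ e) := by
  have hn1 : (1 : ℝ) ≤ n := by exact_mod_cast hn
  refine (measure_iUnion_pairs_le _ (fun A B => {z | ∃ p ∈ A,
          0 ≤ ‖toPts z p - mass (toPts z) A‖ ^ 2 - ‖toPts z p - mass (toPts z) B‖ ^ 2 ∧
          ‖toPts z p - mass (toPts z) A‖ ^ 2 - ‖toPts z p - mass (toPts z) B‖ ^ 2 ≤ ε})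
    (c := n * ENNReal.ofReal (n * ε / σ ^ 2)) fun A B hAB _ hB => ?_).trans ?_
  · have hsub : {z | ∃ p ∈ A,
          0 ≤ ‖toPts z p - mass (toPts z) A‖ ^ 2 - ‖toPts z p - mass (toPts z) B‖ ^ 2 ∧
          ‖toPts z p - mass (toPts z) A‖ ^ 2 - ‖toPts z p - mass (toPts z) B‖ ^ 2 ≤ ε}
        ⊆ ⋃ p ∈ A, {z : Fin n × Fin d → ℝ |
          0 ≤ ‖toPts z p - mass (toPts z) A‖ ^ 2 - ‖toPts z p - mass (toPts z) B‖ ^ 2 ∧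
          ‖toPts z p - mass (toPts z) A‖ ^ 2 - ‖toPts z p - mass (toPts z) B‖ ^ 2 ≤ ε} := by
      rintro z ⟨p, hp, hz⟩
      exact Set.mem_biUnion (x := p) hp hz
    refine (measure_mono hsub).trans ((measure_biUnion_finset_le _ _).trans ?_)
    refine (Finset.sum_le_card_nsmul _ _ _ fun p hp =>
      gaussianPi_switch_le hd m hσ hAB hp hε).trans ?_
    rw [nsmul_eq_mul]
    have : A.card ≤ n := (Finset.card_le_univ A).trans_eq (by simp)
    gcongr
  · have h1 : (2 * n : ℝ≥0∞) ^ M = ENNReal.ofReal ((2 * n : ℝ) ^ M) := by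
      rw [ENNReal.ofReal_pow (by positivity), ENNReal.ofReal_mul (by norm_num)]
      simp
    rw [h1, ← ENNReal.ofReal_natCast, ← ENNReal.ofReal_mul (by positivity),
      ← ENNReal.ofReal_mul (by positivity)]
    refine ENNReal.ofReal_le_ofReal ?_
    have hnσ : 1 ≤ n / σ := by
      rw [le_div_iff₀ hσ]
      linarith
    calc (2 * n : ℝ) ^ M * (n * (n * ε / σ ^ 2))
        = ε * ((2 * n : ℝ) ^ (M : ℝ) * (n / σ) ^ (2 : ℝ)) := by
          rw [Real.rpow_natCast, Real.rpow_ofNat]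
          ring
      -- `1 ≤ n / σ` lets the exponent 2 grow to `e`.
      _ ≤ ε * ((2 * n : ℝ) ^ (2 * e) * (n / σ) ^ e) := by
          gcongr
          linarith
      _ = ε * (4 * n ^ 3 / σ) ^ e := by
          rw [Real.rpow_mul (by positivity), ← Real.mul_rpow (by positivity) (by positivity),
            Real.rpow_ofNat]
          congr 2
          ring
      _ ≤ _ := by
          gcongr
          · norm_num
          · norm_num

/-! ### Combining the estimates -/

lemma gaussianPi_minCenterDist_le {n d k : ℕ} (hd : 2 ≤ d) (hdn : d ≤ n) (m : Fin n × Fin d → ℝ)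
    {σ : ℝ} (hσ : 0 < σ) (hσ1 : σ ≤ 1) {Y e ε : ℝ} (hY : 1 ≤ Y) (he : 2 ≤ e) (hε : 0 ≤ ε) :
    gaussianPi m σ {z | minCenterDist k (toPts z) ε ≤ ENNReal.ofReal (Y * ε ^ (1 / e))}
      ≤ ENNReal.ofReal (ε * (16 * n ^ 5 * Y / σ) ^ e) := by
  have hn : 0 < n := by omega
  have hn1 : (1 : ℝ) ≤ n := by exact_mod_cast hn
  have he0 : 0 < e := by linarith
  set δ := Y * ε ^ (1 / e) with hδ
  have hδ0 : 0 ≤ δ := by positivity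
  have hδe : ∀ c : ℝ, 0 ≤ c → (c * δ) ^ e = ε * (c * Y) ^ e := by
    intro c hc
    rw [hδ, ← mul_assoc, Real.mul_rpow (by positivity) (by positivity), ← Real.rpow_mul hε,
      one_div_mul_cancel he0.ne', Real.rpow_one, mul_comm]
  set X := 8 * n ^ 5 * δ / σ with hX
  have hX0 : 0 ≤ X := by positivity
  have hXe : X ^ e = ε * (8 * n ^ 5 * Y / σ) ^ e := by
    rw [hX, mul_div_right_comm, hδe _ (by positivity), div_mul_eq_mul_div]
  -- The constant is `16 = 2 * 8`: since `2 ≤ 2 ^ e`, it absorbs the sum over the two bad events `U`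
  -- and `V`.
  have h2X : 2 * X ^ e ≤ ε * (16 * n ^ 5 * Y / σ) ^ e := by
    have h1 : (16 * n ^ 5 * Y / σ) ^ e = 2 ^ e * (8 * n ^ 5 * Y / σ) ^ e := by
      rw [← Real.mul_rpow (by norm_num) (by positivity)]
      congr 1
      ring
    rw [h1, hXe, mul_left_comm ε]
    gcongr
    exact Real.self_le_rpow_of_one_le (by norm_num) (by linarith)
  rcases le_or_gt 1 X with hX1 | hX1
  · refine prob_le_one.trans ?_
    rw [ENNReal.one_le_ofReal]
    have := Real.one_le_rpow hX1 he0.le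
    linarith
  -- `e ≤ s` gives `X ^ s ≤ X ^ e`, as `X < 1`; `d ≤ s` serves the count of subsets.
  set s := max d ⌈e⌉₊ with hs
  have hes : e ≤ s := (Nat.le_ceil e).trans (by exact_mod_cast le_max_right _ _)
  have hXpow : ∀ t : ℕ, e ≤ t → X ^ t ≤ X ^ e := by
    intro t ht
    rcases hX0.eq_or_lt with h0 | hpos
    · rw [← h0, Real.zero_rpow he0.ne', zero_pow]
      rintro rfl
      norm_num at ht
      linarith
    · rw [← Real.rpow_natCast]
      exact Real.rpow_le_rpow_of_exponent_ge hpos hX1.le ht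
  set N := {z : Fin n × Fin d → ℝ | ¬ ∀ A B : Finset (Fin n), Disjoint A B → A.Nonempty →
    B.Nonempty → mass (toPts z) A ≠ mass (toPts z) B}
  set U := {z : Fin n × Fin d → ℝ | ∃ (A : Finset (Fin n)) (ℓ : Fin d), d + s ≤ A.card ∧
    z ∈ nearGraph A ℓ (2 * (n * d * δ))}
  set M := d + s - 1 with hM
  have hN : gaussianPi m σ N = 0 := gaussianPi_mass_eq_null (by omega) m hσ
  have hU : gaussianPi m σ U ≤ ENNReal.ofReal (X ^ e) :=
    (gaussianPi_exists_nearGraph_le (by omega) hdn (le_max_left _ _) m hσ hδ0).trans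
      (ENNReal.ofReal_le_ofReal (hXpow s hes))
  have hcover : ∃ V : Set (Fin n × Fin d → ℝ), gaussianPi m σ V ≤ ENNReal.ofReal (X ^ e) ∧
      {z | minCenterDist k (toPts z) ε ≤ ENNReal.ofReal δ} ⊆ N ∪ (U ∪ V) := by
    have hsmall : ∀ {z : Fin n × Fin d → ℝ} {A B : Finset (Fin n)}, z ∉ U → Disjoint A B →
        (∃ ℓ, z ∈ nearGraph (A ∪ B) ℓ (2 * (n * d * δ))) → A.card + B.card ≤ M := by
      intro z A B hzU hAB hz
      by_contra! hcon
      obtain ⟨ℓ, hℓ⟩ := hz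
      refine hzU ⟨A ∪ B, ℓ, ?_, hℓ⟩
      rw [Finset.card_union_of_disjoint hAB]
      omega
    rcases le_or_gt e d with hed | hed
    · have hsd : s = d := max_eq_left (Nat.ceil_le.mpr hed)
      refine ⟨_, (gaussianPi_exists_close_le hn (M := M) (by omega) m hσ hδ0).trans
        (ENNReal.ofReal_le_ofReal (hXpow d hed)), fun z hz => ?_⟩
      by_cases hzN : z ∈ N
      · exact Or.inl hzN
      by_cases hzU : z ∈ U
      · exact Or.inr (Or.inl hzU)
      obtain ⟨A, B, p, hAB, hp, hB, hclose, -, -, hℓ⟩ :=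
        exists_of_minCenterDist_le hδ0 (not_not.mp hzN) hz
      exact Or.inr (Or.inr ⟨A, B, hAB, ⟨p, hp⟩, hB, hsmall hzU hAB hℓ, hclose⟩)
    · have hsd : s = ⌈e⌉₊ := max_eq_right (by exact_mod_cast (hed.trans_le (Nat.le_ceil e)).le)
      have hds : d + 1 ≤ s := by
        rw [hsd]
        exact Nat.lt_ceil.mpr hed
      -- The rounding in `s < e + 1` is compensated by the `-1` in `M` and by `d + 1 ≤ s`.
      have hMe : (M : ℝ) ≤ 2 * e := by
        have h1 : (s : ℝ) < e + 1 := hsd ▸ Nat.ceil_lt_add_one he0.le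
        have h2 : M + 2 ≤ 2 * s := by omega
        have h3 : (M : ℝ) + 2 ≤ 2 * s := by exact_mod_cast h2
        linarith
      refine ⟨_, (gaussianPi_exists_switch_le hd hn he hMe m hσ hσ1 hε).trans
        (ENNReal.ofReal_le_ofReal ?_), fun z hz => ?_⟩
      · rw [hXe]
        refine mul_le_mul_of_nonneg_left (Real.rpow_le_rpow (by positivity) ?_ he0.le) hε
        exact div_le_div_of_nonneg_right (le_mul_of_one_le_right (by positivity) hY) hσ.le
      by_cases hzN : z ∈ N
      · exact Or.inl hzN
      by_cases hzU : z ∈ U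
      · exact Or.inr (Or.inl hzU)
      obtain ⟨A, B, p, hAB, hp, hB, -, hsw, -, hℓ⟩ :=
        exists_of_minCenterDist_le hδ0 (not_not.mp hzN) hz
      exact Or.inr (Or.inr ⟨A, B, hAB, ⟨p, hp⟩, hB, hsmall hzU hAB hℓ, p, hp, hsw⟩)
  obtain ⟨V, hV, hsub⟩ := hcover
  calc _ ≤ gaussianPi m σ N + (gaussianPi m σ U + gaussianPi m σ V) :=
        (measure_mono hsub).trans ((measure_union_le _ _).trans
          (add_le_add le_rfl (measure_union_le _ _)))
    _ ≤ 0 + (ENNReal.ofReal (X ^ e) + ENNReal.ofReal (X ^ e)) := by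
        gcongr
        exact hN.le
    _ = ENNReal.ofReal (2 * X ^ e) := by
        rw [zero_add, ← ENNReal.ofReal_add (by positivity) (by positivity), two_mul]
    _ ≤ _ := ENNReal.ofReal_le_ofReal h2X

end KMeans

theorem mainTheorem2 :
    ∃ C : ℝ, 0 < C ∧
      ∀ (n d k : ℕ), 2 ≤ d → d ≤ n → k ≤ n →
      ∀ (σ : ℝ), 0 < σ → σ ≤ 1 →
      ∀ (x' : Fin n → EuclideanSpace ℝ (Fin d)), (∀ p j, x' p j ∈ Set.Icc (0 : ℝ) 1) →
      ∀ (Ω : Type*) [MeasurableSpace Ω] (P : Measure Ω) [IsProbabilityMeasure P]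
        (G : Fin n → Ω → EuclideanSpace ℝ (Fin d)),
        iIndepFun G P →
        (∀ p, HasLaw (G p) (multivariateGaussian 0 (σ ^ 2 • (1 : Matrix (Fin d) (Fin d) ℝ))) P) →
      ∀ (Y e ε : ℝ), 1 ≤ Y → 2 ≤ e → 0 ≤ ε → ε ≤ 1 →
        P.real {ω | KMeans.minCenterDist k (fun p => x' p + G p ω) ε
            ≤ ENNReal.ofReal (Y * ε ^ (1 / e))}
          ≤ ε * (C * (n : ℝ) ^ 5 * Y / σ) ^ e := by
  refine ⟨16, by norm_num, ?_⟩
  intro n d k hd hdn _ σ hσ hσ1 x' _ Ω _ P _ G hG hlaw Y e ε hY he hε _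
  set Z : Ω → Fin n × Fin d → ℝ := fun ω i => (x' i.1 + G i.1 ω) i.2 with hZ
  have hae : ∀ p, AEMeasurable (G p) P := fun p => (hlaw p).aemeasurable
  have hZm : AEMeasurable Z P := by
    refine aemeasurable_pi_lambda _ fun i => ?_
    exact (show Measurable fun g : EuclideanSpace ℝ (Fin d) => (x' i.1 + g) i.2 by
      fun_prop).comp_aemeasurable (hae i.1)
  have h1 : P {ω | KMeans.minCenterDist k (fun p => x' p + G p ω) ε
      ≤ ENNReal.ofReal (Y * ε ^ (1 / e))} ≤ ENNReal.ofReal (ε * (16 * n ^ 5 * Y / σ) ^ e) :=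
    -- This inequality holds for arbitrary sets, so the event need not be shown measurable.
    calc _ ≤ P.map Z {z | KMeans.minCenterDist k (KMeans.toPts z) ε
          ≤ ENNReal.ofReal (Y * ε ^ (1 / e))} := Measure.le_map_apply hZm _
      _ ≤ _ := by
        rw [hZ, KMeans.map_perturbed_eq_gaussianPi x' P G hG hlaw]
        exact KMeans.gaussianPi_minCenterDist_le hd hdn _ hσ hσ1 hY he hε
  exact ENNReal.toReal_le_of_le_ofReal (by positivity) h1
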